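/- Let $K$ be a field, $R=K[x_1,\dots,x_n]$ with the standard grading, $\mathfrak m=\langle x_1,\dots,x_n\rangle$, and let $I\subseteq R$ be a monomial ideal whose minimal set of monomial generators $G(I)=\{m_1\prec m_2\prec\cdots\prec m_\mu\}$ is totally ordered by $\prec$. A symbol $u(i_1;\dots;i_t)$ of dimension $t$, where $1\le i_1<\cdots<i_t\le\mu$, is called $L$-admissible if $m_q$ does not divide $\operatorname{lcm}(m_{i_h},m_{i_{h+1}},\dots,m_{i_t})$ for all $h<t$ and all $q<i_h$. For $t\ge 0$ let $L^t$ be the free $R$-module on the $L$-admissible symbols of dimension $t$ (so $L^0=R$), and for $t\ge1$ let $\partial_t\colon L^t\to L^{t-1}$ be given by $$\partial_t\,u(i_1;\dots;i_t)=\sum_{k=1}^{t}(-1)^{k+1}\frac{\operatorname{lcm}(m_{i_1},\dots,m_{i_t})}{\operatorname{lcm}(m_{i_1},\dots,\widehat{m_{i_k}},\dots,m_{i_t})}\,u(i_1;\dots;\widehat{i_k};\dots;i_t).$$ This is the Lyubeznik resolution of $R/I$ under $\prec$; it is minimal if $\partial_t(L^t)\subseteq\mathfrak m L^{t-1}$ for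 all $t\ge1$. A nonempty subset $D\subseteq G(I)$ is broken if some $u\in G(I)$ divides $\operatorname{lcm}(D)$ and satisfies $u\prec\min_{\prec}(D)$. A subset $A\subseteq G(I)$ is preserved if no nonempty subset of $A$ is broken. For a finitely generated graded $R$-module $M$, the graded Betti number $\beta_{i,j}(M)$ is the number of summands $R(-j)$ in homological degree $i$ of a minimal graded free resolution of $M$. **Theorem.** Suppose that the Lyubeznik resolution of $R/I$ under $\prec$ is minimal (so that $I$ is a Lyubeznik ideal). Then $R/I$ and $I$ have minimal graded free resolutions, and for all $t\ge1$ and $j\ge0$ $$\beta_{t,j}(R/I)=\beta_{t-1,j}(I),$$ $$\beta_{t-1,j}(I)=\bigl|\{u(i_1;\dots;i_t)\;:\;u\text{ is }L\text{-admissible and }\deg\operatorname{lcm}(m_{i_1},\dots,m_{i_t})=j\}\bigr|,$$ $$\beta_{t-1,j}(I)=\bigl|\{A\subseteq G(I)\;:\;|A|=t,\ A\text{ is preserved and }\deg\operatorname{lcm}(A)=j\}\bigr|.$$ -/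

import Mathlib

open MvPolynomial

noncomputable section

namespace Lyubeznik

/-! Monomials of `R = K[x_1, …, x_n]` are represented by their exponent vectors `a : Fin n →₀ ℕ`.
Divisibility of monomials is `≤`, the least common multiple is the supremum `⊔` (with `lcm ∅ = 1`
being the exponent `0`), an exact quotient is the difference of exponents, and the degree is
`Finsupp.degree`. -/

/-! ### Monomial ideals -/

/-- `I` is a monomial ideal: it is generated by a set of monomials. -/
def IsMonomialIdeal {K : Type*} [Field K] {n : ℕ} (I : Ideal (MvPolynomial (Fin n) K)) : Prop :=
  ∃ S : Set (Fin n →₀ ℕ), I = Ideal.span ((fun a => monomial a (1 : K)) '' S)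

/-- The minimal set `G(I)` of monomial generators of a monomial ideal `I`: the monomials of `I`
that are minimal under divisibility. -/
def minGens {K : Type*} [Field K] {n : ℕ} (I : Ideal (MvPolynomial (Fin n) K)) :
    Set (Fin n →₀ ℕ) :=
  {a | Minimal (fun b => monomial b (1 : K) ∈ I) a}

/-- The homogeneous maximal ideal `⟨x_1, …, x_n⟩` of `K[x_1, …, x_n]`. -/
def irrelevantIdeal (K : Type*) [Field K] (n : ℕ) : Ideal (MvPolynomial (Fin n) K) :=
  Ideal.span (Set.range X)

/-! ### Minimal graded free resolutions and graded Betti numbers -/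

/-- The degree `j` part of the graded free module `⨁_b R(-deg b)`. -/
def freeGrading (K : Type*) [Field K] (n : ℕ) {r : ℕ} (deg : Fin r → ℕ) (j : ℕ) :
    Set (Fin r → MvPolynomial (Fin n) K) :=
  {v | ∀ b, ∀ a ∈ (v b).support, a.degree + deg b = j}

/-- A minimal graded free resolution
`⋯ → F_2 → F_1 → F_0 → M → 0` of a graded `K[x_1, …, x_n]`-module `M = ⨁_j 𝓜 j`, where
`F_i = ⨁_b R(-deg i b)` is a graded free module of finite rank. -/
structure MinimalGradedResolution {K : Type*} [Field K] {n : ℕ} {M : Type*} [AddCommGroup M]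
    [Module (MvPolynomial (Fin n) K) M] (𝓜 : ℕ → AddSubgroup M) where
  /-- the rank of `F_i` -/
  rank : ℕ → ℕ
  /-- the degrees of the basis elements of `F_i` -/
  deg : ∀ i, Fin (rank i) → ℕ
  /-- the differential `F_{i+1} → F_i` -/
  d : ∀ i, (Fin (rank (i + 1)) → MvPolynomial (Fin n) K) →ₗ[MvPolynomial (Fin n) K]
    (Fin (rank i) → MvPolynomial (Fin n) K)
  /-- the augmentation `F_0 → M` -/
  aug : (Fin (rank 0) → MvPolynomial (Fin n) K) →ₗ[MvPolynomial (Fin n) K] M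
  aug_surjective : Function.Surjective aug
  exact_zero : Function.Exact (d 0) aug
  exact_succ : ∀ i, Function.Exact (d (i + 1)) (d i)
  /-- the augmentation preserves degrees -/
  aug_homogeneous : ∀ j, ∀ v ∈ freeGrading K n (deg 0) j, aug v ∈ 𝓜 j
  /-- the differentials preserve degrees -/
  d_homogeneous : ∀ i j, ∀ v ∈ freeGrading K n (deg (i + 1)) j,
    d i v ∈ freeGrading K n (deg i) j
  /-- minimality: the image of each differential lies in `𝔪 F_i` -/
  minimal : ∀ i, LinearMap.range (d i) ≤
    irrelevantIdeal K n • (⊤ : Submodule (MvPolynomial (Fin n) K) _)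

/-- The number of summands `R(-j)` of `F_i`. -/
def MinimalGradedResolution.betti {K : Type*} [Field K] {n : ℕ} {M : Type*} [AddCommGroup M]
    [Module (MvPolynomial (Fin n) K) M] {𝓜 : ℕ → AddSubgroup M}
    (F : MinimalGradedResolution (K := K) (n := n) 𝓜) (i j : ℕ) : ℕ :=
  Nat.card {b : Fin (F.rank i) // F.deg i b = j}

open Classical in
/-- The graded Betti number `β_{i,j}(M)`: the number of summands `R(-j)` in homological degree `i`
of a minimal graded free resolution of `M` (and `0` if there is no such resolution). -/
def gradedBetti {K : Type*} [Field K] {n : ℕ} {M : Type*} [AddCommGroup M]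
    [Module (MvPolynomial (Fin n) K) M] (𝓜 : ℕ → AddSubgroup M) (i j : ℕ) : ℕ :=
  if h : Nonempty (MinimalGradedResolution (K := K) (n := n) 𝓜) then
    (Classical.choice h).betti i j
  else 0

/-- The standard grading of a homogeneous ideal `I`, as a module: degree `j` consists of the
homogeneous polynomials of degree `j` lying in `I`. -/
def idealGrading {K : Type*} [Field K] {n : ℕ} (I : Ideal (MvPolynomial (Fin n) K)) (j : ℕ) :
    AddSubgroup I :=
  (homogeneousSubmodule (Fin n) K j).toAddSubgroup.comap I.subtype.toAddMonoidHom

/-- The standard grading of `R/I`: degree `j` consists of the classes of homogeneous polynomials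
of degree `j`. -/
def quotientGrading {K : Type*} [Field K] {n : ℕ} (I : Ideal (MvPolynomial (Fin n) K)) (j : ℕ) :
    AddSubgroup (MvPolynomial (Fin n) K ⧸ I) :=
  (homogeneousSubmodule (Fin n) K j).toAddSubgroup.map (Submodule.mkQ I).toAddMonoidHom

/-- `β_{i,j}(I)` for a homogeneous ideal `I` of `R`. -/
def bettiIdeal {K : Type*} [Field K] {n : ℕ} (I : Ideal (MvPolynomial (Fin n) K))
    (i j : ℕ) : ℕ :=
  gradedBetti (K := K) (n := n) (idealGrading I) i j

/-- `β_{i,j}(R/I)` for a homogeneous ideal `I` of `R`. -/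
def bettiQuotient {K : Type*} [Field K] {n : ℕ} (I : Ideal (MvPolynomial (Fin n) K))
    (i j : ℕ) : ℕ :=
  gradedBetti (K := K) (n := n) (quotientGrading I) i j

/-! ### Symbols and the Lyubeznik resolution -/

/-- A symbol `u(i_1; …; i_t)` of dimension `t` with `i_1 < ⋯ < i_t`, for a sequence of `μ`
monomials. -/
abbrev Symb (μ t : ℕ) : Type := Fin t ↪o Fin μ

/-- `lcm(m_{i_1}, …, m_{i_t})` for the symbol `u(i_1; …; i_t)`. -/
def symbLcm {n μ : ℕ} (m : Fin μ → Fin n →₀ ℕ) {t : ℕ} (u : Symb μ t) : Fin n →₀ ℕ :=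
  Finset.univ.sup fun k => m (u k)

/-- The symbol `u(i_1; …; i_t)` is `L`-admissible: `m_q` does not divide
`lcm(m_{i_h}, …, m_{i_t})` for all `h < t` and `q < i_h`. (Positions are numbered from `0`
here, so that the last position is `t - 1`.) -/
def IsAdmissible {n μ : ℕ} (m : Fin μ → Fin n →₀ ℕ) {t : ℕ} (u : Symb μ t) : Prop :=
  ∀ h : Fin t, (h : ℕ) + 1 < t → ∀ q < u h, ¬ m q ≤ (Finset.Ici h).sup fun k => m (u k)

/-- The symbol obtained by omitting the entry at position `k`. -/
def face {μ t : ℕ} (u : Symb μ (t + 1)) (k : Fin (t + 1)) : Symb μ t :=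
  (Fin.succAboveOrderEmb k).trans u

theorem IsAdmissible.face {n μ : ℕ} {m : Fin μ → Fin n →₀ ℕ} {t : ℕ} {u : Symb μ (t + 1)}
    (hu : IsAdmissible m u) (k : Fin (t + 1)) : IsAdmissible m (face u k) := by
  intro h ht q hq hle
  have hlast : k.succAbove h < k.succAbove ⟨t - 1, by omega⟩ :=
    (Fin.succAboveOrderEmb k).lt_iff_lt.mpr (by rw [Fin.lt_def]; simp only; omega)
  refine hu (k.succAbove h) ?_ q hq (hle.trans (Finset.sup_le fun l hl => ?_))
  · have := (k.succAbove ⟨t - 1, by omega⟩).isLt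
    rw [Fin.lt_def] at hlast
    omega
  · refine Finset.le_sup (f := fun k => m (u k)) (b := k.succAbove l) ?_
    rw [Finset.mem_Ici] at hl ⊢
    exact (Fin.succAboveOrderEmb k).le_iff_le.mpr hl

/-- The `L`-admissible symbols of dimension `t`. -/
abbrev AdmissibleSymb {n μ : ℕ} (m : Fin μ → Fin n →₀ ℕ) (t : ℕ) : Type :=
  {u : Symb μ t // IsAdmissible m u}

/-- The free module `L^t` on the `L`-admissible symbols of dimension `t`. For `t = 0` the empty
symbol is the only one, so that `L^0 = R`. -/
abbrev LModule (K : Type*) [Field K] {n μ : ℕ} (m : Fin μ → Fin n →₀ ℕ) (t : ℕ) : Type _ :=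
  AdmissibleSymb m t →₀ MvPolynomial (Fin n) K

/-- The differential `∂_{t+1} : L^{t+1} → L^t` of the Lyubeznik resolution. It sends a symbol `u`
to the sum over `k` of `± lcm(u) / lcm(u_k)` times `u_k`, where `u_k` omits the `k`-th entry and
the signs alternate, beginning with `+`. -/
def boundary (K : Type*) [Field K] {n μ : ℕ} (m : Fin μ → Fin n →₀ ℕ) (t : ℕ) :
    LModule K m (t + 1) →ₗ[MvPolynomial (Fin n) K] LModule K m t :=
  Finsupp.linearCombination (MvPolynomial (Fin n) K) fun u : AdmissibleSymb m (t + 1) =>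
    ∑ k : Fin (t + 1), Finsupp.single (⟨face u.1 k, u.2.face k⟩ : AdmissibleSymb m t)
      ((-1) ^ (k : ℕ) * monomial (symbLcm m u.1 - symbLcm m (face u.1 k)) (1 : K))

/-- The Lyubeznik resolution of the ordered sequence `m_1 ≺ ⋯ ≺ m_μ` is minimal:
`∂_t(L^t) ⊆ 𝔪 L^{t-1}` for all `t ≥ 1`. -/
def IsMinimalLyubeznik (K : Type*) [Field K] {n μ : ℕ} (m : Fin μ → Fin n →₀ ℕ) : Prop :=
  ∀ t, LinearMap.range (boundary K m t) ≤
    irrelevantIdeal K n • (⊤ : Submodule (MvPolynomial (Fin n) K) (LModule K m t))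

/-! ### Preserved sets -/

/-- The total order `≺` on the set `{m_1 ≺ ⋯ ≺ m_μ}` given by a sequence of distinct monomials. -/
def Prec {n μ : ℕ} (m : Fin μ → Fin n →₀ ℕ) (u v : Fin n →₀ ℕ) : Prop :=
  ∃ p q : Fin μ, p < q ∧ m p = u ∧ m q = v

/-- A nonempty set `D ⊆ {m_1, …, m_μ}` is broken: some `u ∈ {m_1, …, m_μ}` divides `lcm(D)` and
precedes the least element of `D`, that is, precedes every element of `D`. -/
def IsBroken {n μ : ℕ} (m : Fin μ → Fin n →₀ ℕ) (D : Finset (Fin n →₀ ℕ)) : Prop :=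
  D.Nonempty ∧ ∃ u ∈ Set.range m, u ≤ D.sup id ∧ ∀ v ∈ D, Prec m u v

/-- A set `E ⊆ {m_1, …, m_μ}` is preserved: no subset of `E` is broken. -/
def IsPreserved {n μ : ℕ} (m : Fin μ → Fin n →₀ ℕ) (E : Finset (Fin n →₀ ℕ)) : Prop :=
  ∀ D ⊆ E, ¬ IsBroken m D

end Lyubeznik

end

/-! The Lyubeznik complex is exact for every ordered sequence of monomials. In a fixed multidegree
`a`, a symbol contributes one basis vector exactly when its lcm divides `x^a`, and the differential
becomes the ordinary simplicial boundary (`boundary_basisMultiple`). If `q` is the first index with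
`m q ≤ a`, prepending `q` keeps a symbol admissible and its lcm below `a`, so the complex is a cone
with apex `q`; coning off is a contracting homotopy (`homotopy_identity`). The image of `L^1` in `R`
is `I`, so under the minimality hypothesis the complex resolves `R/I`, and with `L^0` dropped it
resolves `I`.

Since `gradedBetti` is read off an arbitrarily chosen resolution, Betti numbers must also be shown
independent of that choice (`MinimalGradedResolution.betti_eq`). Two minimal covers of a graded
module lift to each other; each composite is the identity plus a nilpotent map
(`isNilpotent_of_coeff_zero`), so the covers are isomorphic and induction passes to the syzygies.
All that is used of a grading is the existence of projections to its components, recorded in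
`HasProjections`.

Finally, admissible symbols correspond to preserved sets (`isPreserved_symbSet_iff`): admissibility
tests the tails of a symbol, and every subset with a given least element lies in the tail starting
there. -/

noncomputable section

namespace Lyubeznik

/-! ### Homogeneous linear maps between graded free modules -/

section Free

variable {K : Type*} [Field K] {n r s : ℕ} (deg : Fin r → ℕ) (deg' : Fin s → ℕ)

/-- The degree `j` part of a graded free module, as an additive subgroup. -/
def freeGradingSubgroup (K : Type*) [Field K] (n : ℕ) {r : ℕ} (deg : Fin r → ℕ) (j : ℕ) :
    AddSubgroup (Fin r → MvPolynomial (Fin n) K) where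
  carrier := freeGrading K n deg j
  zero_mem' := fun b a ha => by simp at ha
  add_mem' := fun {v w} hv hw b a ha => by
    classical
    rcases Finset.mem_union.mp (MvPolynomial.support_add ha) with h | h
    exacts [hv b a h, hw b a h]
  neg_mem' := fun {v} hv b a ha => hv b a (by simpa using ha)

theorem mem_freeGradingSubgroup {j : ℕ} {v : Fin r → MvPolynomial (Fin n) K} :
    v ∈ freeGradingSubgroup K n deg j ↔ v ∈ freeGrading K n deg j := Iff.rfl

theorem single_monomial_mem_freeGrading (b : Fin r) (a : Fin n →₀ ℕ) (c : K) :
    (Pi.single b (monomial a c) : Fin r → MvPolynomial (Fin n) K) ∈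
      freeGrading K n deg (a.degree + deg b) := by
  classical
  intro b' a' ha'
  by_cases h : b' = b
  · subst h
    rw [Pi.single_eq_same] at ha'
    rw [Finset.mem_singleton.mp (support_monomial_subset ha')]
  · simp [Pi.single_eq_of_ne h] at ha'

theorem single_one_mem_freeGrading (b : Fin r) :
    (Pi.single b 1 : Fin r → MvPolynomial (Fin n) K) ∈ freeGrading K n deg (deg b) := by
  simpa using single_monomial_mem_freeGrading deg b 0 (1 : K)

theorem smul_mem_freeGrading {i j : ℕ} {p : MvPolynomial (Fin n) K}
    {v : Fin r → MvPolynomial (Fin n) K} (hp : ∀ a ∈ p.support, a.degree + i = j)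
    (hv : v ∈ freeGrading K n deg i) : p • v ∈ freeGrading K n deg j := by
  classical
  intro b a ha
  obtain ⟨x, hx, y, hy, rfl⟩ := Finset.mem_add.mp (support_mul p (v b) ha)
  have h1 := hp x hx
  have h2 := hv b y hy
  rw [map_add]
  omega

theorem apply_eq_sum_single {M : Type*} [AddCommGroup M] [Module (MvPolynomial (Fin n) K) M]
    (f : (Fin r → MvPolynomial (Fin n) K) →ₗ[MvPolynomial (Fin n) K] M)
    (v : Fin r → MvPolynomial (Fin n) K) : f v = ∑ b, v b • f (Pi.single b 1) := by
  conv_lhs => rw [← (Pi.basisFun (MvPolynomial (Fin n) K) (Fin r)).sum_repr v, map_sum]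
  simp

/-- A linear map that sends basis elements to elements of the same degree preserves degrees. -/
theorem mapsTo_freeGrading {φ : (Fin r → MvPolynomial (Fin n) K) →ₗ[MvPolynomial (Fin n) K]
      (Fin s → MvPolynomial (Fin n) K)}
    (h : ∀ b, φ (Pi.single b 1) ∈ freeGrading K n deg' (deg b)) {j : ℕ}
    {v : Fin r → MvPolynomial (Fin n) K} (hv : v ∈ freeGrading K n deg j) :
    φ v ∈ freeGrading K n deg' j := by
  rw [apply_eq_sum_single φ v, ← mem_freeGradingSubgroup]
  exact sum_mem fun b _ => smul_mem_freeGrading deg' (hv b) (h b)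

/-- The projection of a graded free module to its degree `j` part. -/
def freeComponent (j : ℕ) :
    (Fin r → MvPolynomial (Fin n) K) →+ (Fin r → MvPolynomial (Fin n) K) where
  toFun v b := if deg b ≤ j then homogeneousComponent (j - deg b) (v b) else 0
  map_zero' := by ext1 b; simp
  map_add' v w := by
    ext1 b
    by_cases h : deg b ≤ j <;> simp [h]

theorem coeff_freeComponent (j : ℕ) (v : Fin r → MvPolynomial (Fin n) K) (b : Fin r)
    (a : Fin n →₀ ℕ) :
    coeff a (freeComponent deg j v b) = if a.degree + deg b = j then coeff a (v b) else 0 := by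
  by_cases h : deg b ≤ j
  · have : freeComponent deg j v b = homogeneousComponent (j - deg b) (v b) := if_pos h
    rw [this, coeff_homogeneousComponent]
    congr 1
    apply propext
    omega
  · have : freeComponent deg j v b = 0 := if_neg h
    rw [this, coeff_zero, if_neg (by omega)]

theorem freeComponent_mem (j : ℕ) (v : Fin r → MvPolynomial (Fin n) K) :
    freeComponent deg j v ∈ freeGrading K n deg j := by
  intro b a ha
  rw [mem_support_iff, coeff_freeComponent] at ha
  by_contra h
  exact ha (if_neg h)

theorem freeComponent_of_mem {j : ℕ} {v : Fin r → MvPolynomial (Fin n) K}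
    (hv : v ∈ freeGrading K n deg j) : freeComponent deg j v = v := by
  ext b a
  rw [coeff_freeComponent]
  by_cases h : a ∈ (v b).support
  · rw [if_pos (hv b a h)]
  · rw [notMem_support_iff.mp h, ite_self]

theorem freeComponent_of_mem_of_ne {i j : ℕ} (hij : i ≠ j) {v : Fin r → MvPolynomial (Fin n) K}
    (hv : v ∈ freeGrading K n deg i) : freeComponent deg j v = 0 := by
  ext b a
  rw [coeff_freeComponent, Pi.zero_apply, coeff_zero]
  by_cases h : a ∈ (v b).support
  · rw [if_neg (by rw [hv b a h]; exact hij)]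
  · rw [notMem_support_iff.mp h, ite_self]

end Free

/-- The family `𝓜` of subgroups is the family of components of a grading: there are projections
to each of them that vanish on the others. -/
def HasProjections {M : Type*} [AddCommGroup M] (𝓜 : ℕ → AddSubgroup M) : Prop :=
  ∀ j, ∃ π : M →+ M, (∀ x ∈ 𝓜 j, π x = x) ∧ ∀ i ≠ j, ∀ x ∈ 𝓜 i, π x = 0

section Cover

variable {K : Type*} [Field K] {n : ℕ}

/-- Homogeneous linear maps out of a graded free module commute with projections. -/
theorem projection_apply_eq {M : Type*} [AddCommGroup M] [Module (MvPolynomial (Fin n) K) M]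
    {𝓜 : ℕ → AddSubgroup M} {r : ℕ} {deg : Fin r → ℕ}
    {p : (Fin r → MvPolynomial (Fin n) K) →ₗ[MvPolynomial (Fin n) K] M}
    (hp : ∀ j, ∀ v ∈ freeGrading K n deg j, p v ∈ 𝓜 j) {j : ℕ} {π : M →+ M}
    (h1 : ∀ x ∈ 𝓜 j, π x = x) (h2 : ∀ i ≠ j, ∀ x ∈ 𝓜 i, π x = 0)
    (v : Fin r → MvPolynomial (Fin n) K) : π (p v) = p (freeComponent deg j v) := by
  -- Both sides are additive, so it suffices to compare them on one monomial times one basis vector.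
  -- Such an element is homogeneous, so each side either fixes its image or kills it.
  suffices h : π.comp p.toAddMonoidHom = p.toAddMonoidHom.comp (freeComponent deg j) from
    DFunLike.congr_fun h v
  refine AddMonoidHom.functions_ext' _ _ _ fun b => ?_
  refine AddMonoidHom.ext fun q => MvPolynomial.induction_on' q (fun a c => ?_)
    fun q₁ q₂ e₁ e₂ => by rw [map_add, map_add, e₁, e₂]
  have hm := single_monomial_mem_freeGrading deg b a c
  change π (p (Pi.single b (monomial a c))) = p (freeComponent deg j (Pi.single b (monomial a c)))
  by_cases h : a.degree + deg b = j
  · rw [h] at hm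
    rw [freeComponent_of_mem deg hm, h1 _ (hp j _ hm)]
  · rw [freeComponent_of_mem_of_ne deg h hm, h2 _ h _ (hp _ _ hm), map_zero]

/-- A homogeneous surjection from a graded free module to a graded module, with kernel in `𝔪 F`. -/
structure IsMinimalCover {M : Type*} [AddCommGroup M] [Module (MvPolynomial (Fin n) K) M]
    (𝓜 : ℕ → AddSubgroup M) {r : ℕ} (deg : Fin r → ℕ)
    (p : (Fin r → MvPolynomial (Fin n) K) →ₗ[MvPolynomial (Fin n) K] M) : Prop where
  surjective : Function.Surjective p
  homogeneous : ∀ j, ∀ v ∈ freeGrading K n deg j, p v ∈ 𝓜 j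
  coeff_zero_of_ker : ∀ v, p v = 0 → ∀ b, coeff 0 (v b) = 0

variable {M : Type*} [AddCommGroup M] [Module (MvPolynomial (Fin n) K) M]
  {𝓜 : ℕ → AddSubgroup M} {r : ℕ} {deg : Fin r → ℕ}
  {p : (Fin r → MvPolynomial (Fin n) K) →ₗ[MvPolynomial (Fin n) K] M}

theorem IsMinimalCover.exists_preimage (hp : IsMinimalCover 𝓜 deg p) (h𝓜 : HasProjections 𝓜)
    {j : ℕ} {x : M} (hx : x ∈ 𝓜 j) : ∃ v ∈ freeGrading K n deg j, p v = x := by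
  obtain ⟨π, h1, h2⟩ := h𝓜 j
  obtain ⟨w, rfl⟩ := hp.surjective x
  exact ⟨freeComponent deg j w, freeComponent_mem deg j w, by
    rw [← projection_apply_eq hp.homogeneous h1 h2, h1 _ hx]⟩

/-- Freeness of the source: each basis vector goes to a preimage of its image, chosen homogeneous of
the same degree. -/
theorem IsMinimalCover.exists_lift (hp : IsMinimalCover 𝓜 deg p) (h𝓜 : HasProjections 𝓜)
    {s : ℕ} {deg' : Fin s → ℕ}
    (f : (Fin s → MvPolynomial (Fin n) K) →ₗ[MvPolynomial (Fin n) K] M)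
    (hf : ∀ j, ∀ v ∈ freeGrading K n deg' j, f v ∈ 𝓜 j) :
    ∃ φ : (Fin s → MvPolynomial (Fin n) K) →ₗ[MvPolynomial (Fin n) K]
        (Fin r → MvPolynomial (Fin n) K),
      (∀ v, p (φ v) = f v) ∧ ∀ j, ∀ v ∈ freeGrading K n deg' j, φ v ∈ freeGrading K n deg j := by
  choose w hw hpw using fun b : Fin s =>
    hp.exists_preimage h𝓜 (hf _ _ (single_one_mem_freeGrading deg' b))
  have key : ∀ b, (Pi.basisFun (MvPolynomial (Fin n) K) (Fin s)).constr (MvPolynomial (Fin n) K) w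
      (Pi.single b 1) = w b := fun b => by
    rw [← Pi.basisFun_apply, Module.Basis.constr_basis]
  refine ⟨(Pi.basisFun _ _).constr (MvPolynomial (Fin n) K) w, fun v => ?_, fun j v hv => ?_⟩
  · refine DFunLike.congr_fun (f := p ∘ₗ _) (g := f) ?_ v
    refine (Pi.basisFun _ _).ext fun b => ?_
    rw [LinearMap.comp_apply, Pi.basisFun_apply, key, hpw]
  · exact mapsTo_freeGrading deg' deg (fun b => by rw [key]; exact hw b) hv

/-- A homogeneous endomorphism of a graded free module with values in `𝔪 F` is nilpotent. -/
theorem isNilpotent_of_coeff_zero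
    {N : Module.End (MvPolynomial (Fin n) K) (Fin r → MvPolynomial (Fin n) K)}
    (hN : ∀ j, ∀ v ∈ freeGrading K n deg j, N v ∈ freeGrading K n deg j)
    (h0 : ∀ v b, coeff 0 (N v b) = 0) : IsNilpotent N := by
  -- The entry of `N` from `b'` to `b` is homogeneous of degree `deg b' - deg b` without constant
  -- term, so it vanishes unless `deg b < deg b'`. Each application of `N` therefore lowers the
  -- largest basis degree that occurs.
  have step : ∀ k v, (∀ b, k + 1 ≤ deg b → v b = 0) → ∀ b, k ≤ deg b → N v b = 0 := by
    intro k v hv b hb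
    rw [apply_eq_sum_single N v, Finset.sum_apply]
    refine Finset.sum_eq_zero fun b' _ => ?_
    by_cases hb' : k + 1 ≤ deg b'
    · rw [hv b' hb']; simp
    · have hm := hN _ _ (single_one_mem_freeGrading deg b')
      have : N (Pi.single b' 1) b = 0 := by
        ext a
        by_contra ha
        have hd := hm b a (mem_support_iff.mpr ha)
        have ha0 : a ≠ 0 := by
          rintro rfl
          exact ha (h0 _ b)
        have : a.degree ≠ 0 := fun h => ha0 ((Finsupp.degree_eq_zero_iff a).mp h)
        omega
      rw [Pi.smul_apply, this, smul_zero]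
  have pow : ∀ k v, (∀ b, k ≤ deg b → v b = 0) → (N ^ k) v = 0 := by
    intro k
    induction k with
    | zero => intro v hv; ext1 b; simpa using hv b (Nat.zero_le _)
    | succ k ih =>
      intro v hv
      rw [pow_succ, Module.End.mul_apply]
      exact ih _ (step k v hv)
  -- No basis degree reaches this exponent, so the vanishing condition in `pow` is vacuous.
  refine ⟨Finset.univ.sup deg + 1, LinearMap.ext fun v => pow _ v fun b hb => ?_⟩
  have := Finset.le_sup (f := deg) (Finset.mem_univ b)
  omega

variable {M' : Type*} [AddCommGroup M'] [Module (MvPolynomial (Fin n) K) M']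
  {𝓜' : ℕ → AddSubgroup M'} {s : ℕ} {deg' : Fin s → ℕ}
  {p' : (Fin s → MvPolynomial (Fin n) K) →ₗ[MvPolynomial (Fin n) K] M'}

/-- The difference `φ - 1` maps into the kernel of `p`, hence has no constant terms and is
nilpotent, so `φ = 1 + (φ - 1)` is a unit. -/
theorem IsMinimalCover.bijective_of_comp (hp : IsMinimalCover 𝓜 deg p)
    {φ : Module.End (MvPolynomial (Fin n) K) (Fin r → MvPolynomial (Fin n) K)}
    (hφ : ∀ j, ∀ v ∈ freeGrading K n deg j, φ v ∈ freeGrading K n deg j)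
    (hpφ : ∀ v, p (φ v) = p v) : Function.Bijective φ := by
  have hnil : IsNilpotent (φ - 1) := by
    refine isNilpotent_of_coeff_zero (deg := deg) (fun j v hv => ?_) fun v b => ?_
    · exact (freeGradingSubgroup K n deg j).sub_mem (hφ j v hv) hv
    · refine hp.coeff_zero_of_ker _ ?_ b
      rw [LinearMap.sub_apply, map_sub, hpφ, Module.End.one_apply, sub_self]
  have := hnil.isUnit_one_add
  rw [add_sub_cancel] at this
  exact (Module.End.isUnit_iff φ).mp this

/-- Minimal covers of isomorphic graded modules are isomorphic. -/
theorem IsMinimalCover.exists_equiv (hp : IsMinimalCover 𝓜 deg p) (hp' : IsMinimalCover 𝓜' deg' p')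
    (h𝓜 : HasProjections 𝓜) (h𝓜' : HasProjections 𝓜') (e : M ≃ₗ[MvPolynomial (Fin n) K] M')
    (he : ∀ j x, x ∈ 𝓜 j ↔ e x ∈ 𝓜' j) :
    ∃ φ : (Fin r → MvPolynomial (Fin n) K) ≃ₗ[MvPolynomial (Fin n) K]
        (Fin s → MvPolynomial (Fin n) K),
      (∀ v, p' (φ v) = e (p v)) ∧
        ∀ j v, v ∈ freeGrading K n deg j ↔ φ v ∈ freeGrading K n deg' j := by
  obtain ⟨φ, hφ, hφd⟩ := hp'.exists_lift h𝓜' (deg' := deg) (e.toLinearMap ∘ₗ p)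
    fun j v hv => (he j _).mp (hp.homogeneous j v hv)
  obtain ⟨ψ, hψ, hψd⟩ := hp.exists_lift h𝓜 (deg' := deg') (e.symm.toLinearMap ∘ₗ p')
    fun j v hv => (he j _).mpr (by simpa using hp'.homogeneous j v hv)
  have h1 : Function.Bijective (ψ ∘ₗ φ) := hp.bijective_of_comp
    (fun j v hv => hψd j _ (hφd j v hv)) fun v => by simp [hφ, hψ]
  have h2 : Function.Bijective (φ ∘ₗ ψ) := hp'.bijective_of_comp
    (fun j v hv => hφd j _ (hψd j v hv)) fun v => by simp [hφ, hψ]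
  have hb : Function.Bijective φ :=
    ⟨Function.Injective.of_comp (f := ψ) h1.1, Function.Surjective.of_comp (g := ψ) h2.2⟩
  refine ⟨LinearEquiv.ofBijective φ hb, fun v => hφ v, fun j v => ⟨hφd j v, fun hv => ?_⟩⟩
  -- `φ` commutes with the degree `j` projections, so if `φ v` equals its own component, injectivity
  -- gives the same for `v`.
  have h3 := projection_apply_eq (𝓜 := freeGradingSubgroup K n deg') hφd
    (fun x hx => freeComponent_of_mem deg' hx)
    (fun i hi x hx => freeComponent_of_mem_of_ne deg' hi hx) v (j := j)
  rw [freeComponent_of_mem deg' (show φ v ∈ _ from hv)] at h3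
  rw [hb.1 h3]
  exact freeComponent_mem deg j v

/-- Isomorphic graded free modules have the same number of basis elements in each degree. -/
theorem card_degree_eq (φ : (Fin r → MvPolynomial (Fin n) K) ≃ₗ[MvPolynomial (Fin n) K]
      (Fin s → MvPolynomial (Fin n) K))
    (hφ : ∀ j v, v ∈ freeGrading K n deg j ↔ φ v ∈ freeGrading K n deg' j) (j : ℕ) :
    Nat.card {b // deg b = j} = Nat.card {b // deg' b = j} := by
  classical
  -- The constant terms of `φ` and `φ.symm` between basis vectors of degree `j` form mutually
  -- inverse matrices over `K`, so these matrices are square. This is proved for one order of the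
  -- product and applied to both `φ` and `φ.symm`.
  have aux : ∀ {r s : ℕ} {deg : Fin r → ℕ} {deg' : Fin s → ℕ}
      (φ : (Fin r → MvPolynomial (Fin n) K) ≃ₗ[MvPolynomial (Fin n) K]
        (Fin s → MvPolynomial (Fin n) K))
      (_ : ∀ j v, v ∈ freeGrading K n deg j ↔ φ v ∈ freeGrading K n deg' j),
      (Matrix.of fun (b : {b // deg b = j}) (c : {c // deg' c = j}) =>
        coeff 0 (φ (Pi.single b.1 1) c.1)) *
      (Matrix.of fun (c : {c // deg' c = j}) (b : {b // deg b = j}) =>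
        coeff 0 (φ.symm (Pi.single c.1 1) b.1)) = 1 := by
    intro r s deg deg' φ hφ
    ext b b'
    rw [Matrix.mul_apply]
    have h1 : φ.symm (φ (Pi.single b.1 1)) b'.1 = (Pi.single b.1 1 : Fin r → _) b'.1 := by simp
    rw [← LinearEquiv.coe_coe φ.symm, apply_eq_sum_single, Finset.sum_apply] at h1
    have h2 := congrArg constantCoeff h1
    rw [map_sum] at h2
    have h3 : (1 : Matrix {b // deg b = j} {b // deg b = j} K) b b' =
        constantCoeff ((Pi.single b.1 1 : Fin r → MvPolynomial (Fin n) K) b'.1) := by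
      rw [Matrix.one_apply, Pi.single_apply]
      by_cases h : b = b'
      · simp [h]
      · rw [if_neg h, if_neg (fun h' => h (Subtype.ext h'.symm)), map_zero]
    rw [h3, ← h2]
    -- Between basis vectors of different degrees an entry has no constant term, so the sum over all
    -- `c` reduces to those of degree `j`.
    have h4 : ∀ c ∉ Finset.univ.filter (fun c => deg' c = j),
        coeff 0 (φ (Pi.single b.1 1) c) * coeff 0 (φ.symm (Pi.single c 1) b'.1) = 0 := by
      intro c hc
      rw [Finset.mem_filter_univ] at hc
      have hm := (hφ _ _).mp (single_one_mem_freeGrading (K := K) (n := n) deg b.1)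
      have : coeff 0 (φ (Pi.single b.1 1) c) = 0 := by
        by_contra h0
        have := hm c 0 (mem_support_iff.mpr h0)
        rw [map_zero, zero_add, b.2] at this
        exact hc this
      rw [this, zero_mul]
    calc _ = ∑ c ∈ Finset.univ.filter (fun c => deg' c = j),
          coeff 0 (φ (Pi.single b.1 1) c) * coeff 0 (φ.symm (Pi.single c 1) b'.1) :=
        (Finset.sum_subtype (p := fun c => deg' c = j) _ (fun c => Finset.mem_filter_univ c)
          (fun c => coeff 0 (φ (Pi.single b.1 1) c) *
            coeff 0 (φ.symm (Pi.single c 1) b'.1))).symm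
      _ = ∑ c, coeff 0 (φ (Pi.single b.1 1) c) * coeff 0 (φ.symm (Pi.single c 1) b'.1) :=
        Finset.sum_subset (Finset.subset_univ _) fun c _ hc => h4 c hc
      _ = _ := Finset.sum_congr rfl fun c _ => by
        rw [Pi.smul_apply, smul_eq_mul, map_mul]; rfl
  have e1 := aux φ hφ
  have e2 := aux φ.symm (fun j v => by simpa using (hφ j (φ.symm v)).symm)
  rw [Nat.card_eq_fintype_card, Nat.card_eq_fintype_card]
  exact Matrix.square_of_invertible _ _ e1 e2

end Cover

/-! ### Uniqueness of graded Betti numbers -/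

section Uniqueness

universe u v

variable {K : Type u} [Field K] {n : ℕ}

theorem constantCoeff_eq_zero_of_mem_irrelevantIdeal {p : MvPolynomial (Fin n) K}
    (hp : p ∈ irrelevantIdeal K n) : coeff 0 p = 0 := by
  have : irrelevantIdeal K n ≤ RingHom.ker (constantCoeff (σ := Fin n) (R := K)) := by
    rw [irrelevantIdeal, Ideal.span_le]
    rintro _ ⟨i, rfl⟩
    exact constantCoeff_X _ i
  exact this hp

theorem coeff_zero_of_mem_smul_top {r : ℕ} {v : Fin r → MvPolynomial (Fin n) K}
    (hv : v ∈ irrelevantIdeal K n •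
      (⊤ : Submodule (MvPolynomial (Fin n) K) (Fin r → MvPolynomial (Fin n) K))) (b : Fin r) :
    coeff 0 (v b) = 0 := by
  refine Submodule.smul_induction_on hv (fun p hp w _ => ?_) fun x y hx hy => ?_
  · exact constantCoeff_eq_zero_of_mem_irrelevantIdeal (Ideal.mul_mem_right _ _ hp)
  · rw [Pi.add_apply, coeff_add, hx, hy, add_zero]

variable {M : Type v} [AddCommGroup M] [Module (MvPolynomial (Fin n) K) M]
  {𝓜 : ℕ → AddSubgroup M}

theorem MinimalGradedResolution.isMinimalCover
    (F : MinimalGradedResolution (K := K) (n := n) 𝓜) : IsMinimalCover 𝓜 (F.deg 0) F.aug where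
  surjective := F.aug_surjective
  homogeneous := F.aug_homogeneous
  coeff_zero_of_ker v hv :=
    coeff_zero_of_mem_smul_top (F.minimal 0 ((F.exact_zero v).mp hv))

/-- The grading of the first syzygy module. -/
def MinimalGradedResolution.kerGrading (F : MinimalGradedResolution (K := K) (n := n) 𝓜) (j : ℕ) :
    AddSubgroup (LinearMap.ker F.aug) :=
  (freeGradingSubgroup K n (F.deg 0) j).comap (LinearMap.ker F.aug).subtype.toAddMonoidHom

/-- The augmentation commutes with projections, so its kernel is stable under taking components.
This keeps the induction on syzygies going. -/
theorem MinimalGradedResolution.hasProjections_kerGrading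
    (F : MinimalGradedResolution (K := K) (n := n) 𝓜) (h𝓜 : HasProjections 𝓜) :
    HasProjections F.kerGrading := by
  intro j
  obtain ⟨π, h1, h2⟩ := h𝓜 j
  have hker : ∀ v : LinearMap.ker F.aug,
      ((freeComponent (F.deg 0) j).comp (LinearMap.ker F.aug).subtype.toAddMonoidHom) v ∈
        (LinearMap.ker F.aug).toAddSubgroup := by
    intro v
    change F.aug (freeComponent (F.deg 0) j v) = 0
    rw [← projection_apply_eq F.aug_homogeneous h1 h2, LinearMap.mem_ker.mp v.2, map_zero]
  refine ⟨AddMonoidHom.codRestrict _ _ hker, fun x hx => ?_, fun i hi x hx => ?_⟩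
  · exact Subtype.ext (freeComponent_of_mem (F.deg 0) hx)
  · exact Subtype.ext (freeComponent_of_mem_of_ne (F.deg 0) hi hx)

/-- The resolution of the first syzygy module obtained by omitting the first free module. -/
def MinimalGradedResolution.syzygy (F : MinimalGradedResolution (K := K) (n := n) 𝓜) :
    MinimalGradedResolution (K := K) (n := n) F.kerGrading where
  rank i := F.rank (i + 1)
  deg i := F.deg (i + 1)
  d i := F.d (i + 1)
  aug := (F.d 0).codRestrict _ fun v => F.exact_zero.apply_apply_eq_zero v
  aug_surjective := fun ⟨v, hv⟩ => by
    obtain ⟨w, hw⟩ := (F.exact_zero v).mp hv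
    exact ⟨w, Subtype.ext hw⟩
  exact_zero := fun v => by
    rw [← F.exact_succ 0 v]
    exact Subtype.ext_iff
  exact_succ i := F.exact_succ (i + 1)
  aug_homogeneous j v hv := F.d_homogeneous 0 j v hv
  d_homogeneous i := F.d_homogeneous (i + 1)
  minimal i := F.minimal (i + 1)

/-- The inductive step for uniqueness: the isomorphism between the covers gives the count in
homological degree `0` and restricts to a graded isomorphism of first syzygies. -/
theorem MinimalGradedResolution.exists_equiv {M' : Type*} [AddCommGroup M']
    [Module (MvPolynomial (Fin n) K) M'] {𝓜' : ℕ → AddSubgroup M'}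
    (h𝓜 : HasProjections 𝓜) (h𝓜' : HasProjections 𝓜') (e : M ≃ₗ[MvPolynomial (Fin n) K] M')
    (he : ∀ j x, x ∈ 𝓜 j ↔ e x ∈ 𝓜' j) (F : MinimalGradedResolution (K := K) (n := n) 𝓜)
    (F' : MinimalGradedResolution (K := K) (n := n) 𝓜') :
    (∀ j, F.betti 0 j = F'.betti 0 j) ∧
      ∃ e' : LinearMap.ker F.aug ≃ₗ[MvPolynomial (Fin n) K] LinearMap.ker F'.aug,
        ∀ j x, x ∈ F.kerGrading j ↔ e' x ∈ F'.kerGrading j := by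
  obtain ⟨φ, hφ, hφd⟩ := F.isMinimalCover.exists_equiv F'.isMinimalCover h𝓜 h𝓜' e he
  refine ⟨fun j => card_degree_eq φ hφd j, φ.ofSubmodules _ _ ?_, fun j x => hφd j x⟩
  ext v
  rw [Submodule.mem_map_equiv, LinearMap.mem_ker, LinearMap.mem_ker]
  have := hφ (φ.symm v)
  rw [φ.apply_symm_apply] at this
  rw [this, e.map_eq_zero_iff]

/-- Minimal graded free resolutions of isomorphic graded modules have equal Betti numbers, for
modules in the universe of the coefficient field. -/
theorem MinimalGradedResolution.betti_eq_of_equiv_aux (i : ℕ) :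
    ∀ {M M' : Type u} [AddCommGroup M] [AddCommGroup M'] [Module (MvPolynomial (Fin n) K) M]
      [Module (MvPolynomial (Fin n) K) M'] {𝓜 : ℕ → AddSubgroup M} {𝓜' : ℕ → AddSubgroup M'}
      (_ : HasProjections 𝓜) (_ : HasProjections 𝓜') (e : M ≃ₗ[MvPolynomial (Fin n) K] M')
      (_ : ∀ j x, x ∈ 𝓜 j ↔ e x ∈ 𝓜' j) (F : MinimalGradedResolution (K := K) (n := n) 𝓜)
      (F' : MinimalGradedResolution (K := K) (n := n) 𝓜') (j : ℕ), F.betti i j = F'.betti i j := by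
  induction i with
  | zero =>
    intro M M' _ _ _ _ 𝓜 𝓜' h𝓜 h𝓜' e he F F' j
    exact (exists_equiv h𝓜 h𝓜' e he F F').1 j
  | succ i ih =>
    intro M M' _ _ _ _ 𝓜 𝓜' h𝓜 h𝓜' e he F F' j
    obtain ⟨e', he'⟩ := (exists_equiv h𝓜 h𝓜' e he F F').2
    exact ih (F.hasProjections_kerGrading h𝓜) (F'.hasProjections_kerGrading h𝓜') e' he'
      F.syzygy F'.syzygy j

/-- Any two minimal graded free resolutions of a graded module have equal Betti numbers. -/
theorem MinimalGradedResolution.betti_eq (h𝓜 : HasProjections 𝓜)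
    (F F' : MinimalGradedResolution (K := K) (n := n) 𝓜) (i j : ℕ) : F.betti i j = F'.betti i j := by
  -- One step is taken by hand: `M` may live in any universe, but its syzygies are submodules of a
  -- free module and live in the universe of `K`, where the induction runs.
  obtain ⟨h0, e', he'⟩ := exists_equiv h𝓜 h𝓜 (LinearEquiv.refl _ _) (fun _ _ => Iff.rfl) F F'
  cases i with
  | zero => exact h0 j
  | succ i =>
    exact betti_eq_of_equiv_aux i (F.hasProjections_kerGrading h𝓜)
      (F'.hasProjections_kerGrading h𝓜) e' he' F.syzygy F'.syzygy j

theorem gradedBetti_eq (h𝓜 : HasProjections 𝓜)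
    (F : MinimalGradedResolution (K := K) (n := n) 𝓜) (i j : ℕ) :
    gradedBetti (K := K) (n := n) 𝓜 i j = F.betti i j := by
  rw [gradedBetti, dif_pos ⟨F⟩]
  exact MinimalGradedResolution.betti_eq h𝓜 _ _ i j

end Uniqueness

/-! ### Gradings of a monomial ideal and its quotient -/

section MonomialIdeal

variable {K : Type*} [Field K] {n : ℕ} {I : Ideal (MvPolynomial (Fin n) K)}

theorem IsMonomialIdeal.mem_of_support_subset (hI : IsMonomialIdeal I)
    {p q : MvPolynomial (Fin n) K} (hp : p ∈ I) (h : q.support ⊆ p.support) : q ∈ I := by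
  obtain ⟨S, rfl⟩ := hI
  rw [mem_ideal_span_monomial_image] at hp ⊢
  exact fun a ha => hp a (h ha)

theorem IsMonomialIdeal.homogeneousComponent_mem (hI : IsMonomialIdeal I)
    {p : MvPolynomial (Fin n) K} (hp : p ∈ I) (j : ℕ) : homogeneousComponent j p ∈ I := by
  refine hI.mem_of_support_subset hp fun a ha => ?_
  rw [mem_support_iff, coeff_homogeneousComponent] at ha
  rw [mem_support_iff]
  exact fun h => ha (by rw [h, ite_self])

theorem homogeneousComponent_of_isHomogeneous {p : MvPolynomial (Fin n) K} {i : ℕ}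
    (hp : p ∈ homogeneousSubmodule (Fin n) K i) (j : ℕ) :
    homogeneousComponent j p = if i = j then p else 0 := by
  rw [homogeneousComponent_of_mem hp]
  exact if_congr eq_comm rfl rfl

theorem IsMonomialIdeal.hasProjections_idealGrading (hI : IsMonomialIdeal I) :
    HasProjections (idealGrading I) := by
  intro j
  refine ⟨AddMonoidHom.codRestrict ((homogeneousComponent j).toAddMonoidHom.comp
    I.subtype.toAddMonoidHom) (Submodule.toAddSubgroup I)
      fun x => hI.homogeneousComponent_mem x.2 j, fun x hx => ?_, fun i hi x hx => ?_⟩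
  · exact Subtype.ext ((homogeneousComponent_of_isHomogeneous hx j).trans (if_pos rfl))
  · exact Subtype.ext ((homogeneousComponent_of_isHomogeneous hx j).trans (if_neg hi))

theorem IsMonomialIdeal.hasProjections_quotientGrading (hI : IsMonomialIdeal I) :
    HasProjections (quotientGrading I) := by
  intro j
  have key : Submodule.toAddSubgroup I ≤ ((Submodule.mkQ I).toAddMonoidHom.comp
      (homogeneousComponent j).toAddMonoidHom).ker := fun x hx =>
    (Submodule.Quotient.mk_eq_zero I).mpr (hI.homogeneousComponent_mem hx j)
  refine ⟨QuotientAddGroup.lift (Submodule.toAddSubgroup I) _ key, ?_, ?_⟩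
  · rintro _ ⟨p, hp, rfl⟩
    exact congrArg (Submodule.mkQ I)
      ((homogeneousComponent_of_isHomogeneous hp j).trans (if_pos rfl))
  · rintro i hi _ ⟨p, hp, rfl⟩
    exact (congrArg (Submodule.mkQ I)
      ((homogeneousComponent_of_isHomogeneous hp j).trans (if_neg hi))).trans (map_zero _)

theorem exists_mem_minGens_le {a : Fin n →₀ ℕ} (ha : monomial a (1 : K) ∈ I) :
    ∃ b ∈ minGens I, b ≤ a := by
  obtain ⟨b, hb, hmin⟩ := exists_minimal_le_of_wellFoundedLT
    (fun b => monomial b (1 : K) ∈ I) a ha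
  exact ⟨b, hmin, hb⟩

theorem eq_of_le_of_mem_minGens {a b : Fin n →₀ ℕ} (ha : a ∈ minGens I) (hb : b ∈ minGens I)
    (hab : a ≤ b) : a = b :=
  le_antisymm hab (Minimal.le_of_le (P := fun b => monomial b (1 : K) ∈ I) hb
    (Minimal.prop (P := fun b => monomial b (1 : K) ∈ I) ha) hab)

/-- A monomial ideal is generated by its minimal generators. -/
theorem IsMonomialIdeal.eq_span_minGens (hI : IsMonomialIdeal I) :
    I = Ideal.span ((fun a => monomial a (1 : K)) '' minGens I) := by
  refine le_antisymm (fun p hp => ?_) (Ideal.span_le.mpr ?_)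
  · rw [mem_ideal_span_monomial_image]
    intro a ha
    refine exists_mem_minGens_le (hI.mem_of_support_subset hp fun b hb => ?_)
    rwa [Finset.mem_singleton.mp (support_monomial_subset hb)]
  · rintro _ ⟨a, ha, rfl⟩
    exact Minimal.prop (P := fun b => monomial b (1 : K) ∈ I) ha

end MonomialIdeal

/-! ### Exactness of the Lyubeznik resolution -/

section Exactness

variable {K : Type*} [Field K] {n μ : ℕ} {m : Fin μ → Fin n →₀ ℕ} {t : ℕ}

/-- The symbol `u(q; i_1; …; i_t)` for `q < i_1`. -/
def Symb.cons (q : Fin μ) (u : Symb μ t) (h : ∀ k, q < u k) : Symb μ (t + 1) :=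
  OrderEmbedding.ofStrictMono (Fin.cons q u) <| by
    intro k l hkl
    induction l using Fin.cases with
    | zero => exact absurd hkl (Fin.not_lt_zero k)
    | succ l =>
      induction k using Fin.cases with
      | zero => simpa using h l
      | succ k => simpa using hkl

@[simp]
theorem Symb.cons_zero (q : Fin μ) (u : Symb μ t) (h : ∀ k, q < u k) : Symb.cons q u h 0 = q := rfl

@[simp]
theorem Symb.cons_succ (q : Fin μ) (u : Symb μ t) (h : ∀ k, q < u k) (k : Fin t) :
    Symb.cons q u h k.succ = u k := rfl

theorem face_apply (u : Symb μ (t + 1)) (k : Fin (t + 1)) (l : Fin t) :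
    face u k l = u (k.succAbove l) := rfl

theorem lt_face {q : Fin μ} {u : Symb μ (t + 1)} (h : ∀ k, q < u k) (k : Fin (t + 1)) (l : Fin t) :
    q < face u k l := h _

theorem face_cons_zero (q : Fin μ) (u : Symb μ t) (h : ∀ k, q < u k) :
    face (Symb.cons q u h) 0 = u :=
  RelEmbedding.ext fun _ => rfl

theorem face_cons_succ (q : Fin μ) (u : Symb μ (t + 1)) (h : ∀ k, q < u k) (k : Fin (t + 1)) :
    face (Symb.cons q u h) k.succ = Symb.cons q (face u k) (lt_face h k) := by
  ext l
  induction l using Fin.cases with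
  | zero => simp [face_apply]
  | succ l => simp [face_apply]

theorem cons_face_zero (u : Symb μ (t + 1)) :
    Symb.cons (u 0) (face u 0) (fun k => u.lt_iff_lt.mpr k.succ_pos) = u := by
  ext l
  induction l using Fin.cases with
  | zero => rfl
  | succ l => rfl

/-- Deleting the same two entries in the opposite order; this is the pairing behind `∂ ∂ = 0`. -/
theorem face_face (u : Symb μ (t + 2)) (k : Fin (t + 2)) (l : Fin (t + 1)) :
    face (face u (k.succAbove l)) (l.predAbove k) = face (face u k) l := by
  ext i
  simp only [face_apply]
  rw [Fin.succAbove_succAbove_succAbove_predAbove]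

theorem symbLcm_le_iff {u : Symb μ t} {a : Fin n →₀ ℕ} : symbLcm m u ≤ a ↔ ∀ k, m (u k) ≤ a := by
  simp [symbLcm]

theorem symbLcm_face_le (u : Symb μ (t + 1)) (k : Fin (t + 1)) :
    symbLcm m (face u k) ≤ symbLcm m u :=
  symbLcm_le_iff.mpr fun l => symbLcm_le_iff.mp le_rfl (k.succAbove l)

theorem symbLcm_cons_le {q : Fin μ} {u : Symb μ t} (h : ∀ k, q < u k) {a : Fin n →₀ ℕ}
    (hq : m q ≤ a) (hu : symbLcm m u ≤ a) : symbLcm m (Symb.cons q u h) ≤ a := by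
  rw [symbLcm_le_iff] at hu ⊢
  intro k
  induction k using Fin.cases with
  | zero => exact hq
  | succ k => exact hu k

/-- `q` is the first index such that `m_q` divides the monomial with exponent `a`. -/
def IsFirst (m : Fin μ → Fin n →₀ ℕ) (a : Fin n →₀ ℕ) (q : Fin μ) : Prop :=
  m q ≤ a ∧ ∀ p < q, ¬ m p ≤ a

theorem IsFirst.unique {a : Fin n →₀ ℕ} {p q : Fin μ} (hp : IsFirst m a p) (hq : IsFirst m a q) :
    p = q := by
  rcases lt_trichotomy p q with h | h | h
  exacts [absurd hp.1 (hq.2 p h), h, absurd hq.1 (hp.2 q h)]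

theorem exists_isFirst_le {a : Fin n →₀ ℕ} {p : Fin μ} (hp : m p ≤ a) :
    ∃ q ≤ p, IsFirst m a q := by
  obtain ⟨q, hq, hmin⟩ := exists_minimal_le_of_wellFoundedLT (fun q => m q ≤ a) p hp
  exact ⟨q, hq, hmin.prop, fun r hr hle => absurd (hmin.le_of_le hle hr.le) (not_le.mpr hr)⟩

/-- Only the condition at the new first entry is new: the enlarged lcm still divides `x^a`, and no
generator before `q` divides `x^a`. The other conditions are those of `u`. -/
theorem IsAdmissible.cons {u : Symb μ t} (hu : IsAdmissible m u) {a : Fin n →₀ ℕ}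
    (hua : symbLcm m u ≤ a) {q : Fin μ} (hq : IsFirst m a q) (h : ∀ k, q < u k) :
    IsAdmissible m (Symb.cons q u h) := by
  intro k hk p hp hle
  induction k using Fin.cases with
  | zero =>
    refine hq.2 p hp (hle.trans (Finset.sup_le fun l _ => ?_))
    exact symbLcm_le_iff.mp (symbLcm_cons_le h hq.1 hua) l
  | succ k =>
    refine hu k (by simpa using hk) p hp (hle.trans (Finset.sup_le fun l hl => ?_))
    rw [Finset.mem_Ici] at hl
    induction l using Fin.cases with
    | zero => exact absurd hl (by simp)
    | succ l =>
      exact Finset.le_sup (f := fun k => m (u k)) (Finset.mem_Ici.mpr (Fin.succ_le_succ_iff.mp hl))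

variable (K) in
/-- The multiple of the basis element of an `L`-admissible symbol that has multidegree `a`. -/
def basisMultiple (u : AdmissibleSymb m t) (a : Fin n →₀ ℕ) : LModule K m t :=
  Finsupp.single u (monomial (a - symbLcm m u.1) 1)

theorem single_eq_basisMultiple {t : ℕ} (u : AdmissibleSymb m t) :
    Finsupp.single u 1 = basisMultiple K u (symbLcm m u.1) := by
  rw [basisMultiple, tsub_self]
  rfl

/-- The face of an admissible symbol. -/
def AdmissibleSymb.face (u : AdmissibleSymb m (t + 1)) (k : Fin (t + 1)) : AdmissibleSymb m t :=
  ⟨Lyubeznik.face u.1 k, u.2.face k⟩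

/-- The monomial coefficients telescope once the multidegree `a` is fixed, leaving only the
simplicial signs. -/
theorem boundary_basisMultiple (u : AdmissibleSymb m (t + 1)) {a : Fin n →₀ ℕ}
    (h : symbLcm m u.1 ≤ a) : boundary K m t (basisMultiple K u a) =
      ∑ k : Fin (t + 1), (-1 : K) ^ (k : ℕ) • basisMultiple K (u.face k) a := by
  rw [boundary, basisMultiple, Finsupp.linearCombination_single, Finset.smul_sum]
  refine Finset.sum_congr rfl fun k _ => ?_
  rw [Finsupp.smul_single, basisMultiple, Finsupp.smul_single]
  congr 1
  have hk : symbLcm m (face u.1 k) ≤ symbLcm m u.1 := symbLcm_face_le u.1 k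
  have : a - symbLcm m (face u.1 k) =
      (a - symbLcm m u.1) + (symbLcm m u.1 - symbLcm m (face u.1 k)) :=
    (tsub_add_tsub_cancel h hk).symm
  rw [smul_eq_mul, smul_eq_C_mul, map_pow, map_neg, C_1, mul_left_comm, monomial_mul, one_mul,
    ← this]
  rfl

/-- Linear maps that agree on the multiples of basis elements by monomials are equal. -/
theorem LModule.hom_ext {N : Type*} [AddCommGroup N] [Module K N] {f g : LModule K m t →ₗ[K] N}
    (h : ∀ (u : AdmissibleSymb m t) (a : Fin n →₀ ℕ), symbLcm m u.1 ≤ a →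
      f (basisMultiple K u a) = g (basisMultiple K u a)) : f = g := by
  refine Finsupp.lhom_ext' fun u => (basisMonomials (Fin n) K).ext fun b => ?_
  have := h u (b + symbLcm m u.1) le_add_self
  rw [basisMultiple, add_tsub_cancel_right] at this
  simpa using this

theorem boundary_boundary (x : LModule K m (t + 2)) :
    boundary K m t (boundary K m (t + 1) x) = 0 := by
  suffices h : (boundary K m t ∘ₗ boundary K m (t + 1)).restrictScalars K = 0 from
    DFunLike.congr_fun h x
  refine LModule.hom_ext fun u a ha => ?_
  change boundary K m t (boundary K m (t + 1) (basisMultiple K u a)) = 0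
  rw [boundary_basisMultiple u ha, map_sum]
  have h1 : ∀ k : Fin (t + 2), boundary K m t ((-1 : K) ^ (k : ℕ) • basisMultiple K (u.face k) a) =
      ∑ l : Fin (t + 1), (-1 : K) ^ ((k : ℕ) + (l : ℕ)) •
        basisMultiple K ((u.face k).face l) a := by
    intro k
    rw [LinearMap.map_smul_of_tower, boundary_basisMultiple _ ((symbLcm_face_le u.1 k).trans ha),
      Finset.smul_sum]
    exact Finset.sum_congr rfl fun l _ => by rw [smul_smul, pow_add]
  rw [Finset.sum_congr rfl fun k _ => h1 k, ← Fintype.sum_prod_type' (fun (k : Fin (t + 2)) (l : Fin (t + 1)) =>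
    (-1 : K) ^ ((k : ℕ) + (l : ℕ)) • basisMultiple K ((u.face k).face l) a)]
  -- Each pair of deletions is matched with the same pair in the other order, which yields the same
  -- face with the opposite sign.
  refine Finset.sum_involution (fun x _ => (x.1.succAbove x.2, x.2.predAbove x.1))
    (fun x _ => ?_) (fun x _ _ h => ?_) (fun _ _ => Finset.mem_univ _) (fun x _ => ?_)
  · have hf : (u.face (x.1.succAbove x.2)).face (x.2.predAbove x.1) =
        (u.face x.1).face x.2 := Subtype.ext (face_face u.1 x.1 x.2)
    rw [hf, Fin.neg_one_pow_succAbove_add_predAbove, neg_smul, add_neg_cancel]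
  · exact Fin.succAbove_ne x.1 x.2 (congrArg Prod.fst h)
  · simp [Fin.succAbove_succAbove_predAbove, Fin.predAbove_predAbove_succAbove]

open Classical in
variable (K m t) in
/-- The contracting homotopy: on the part of multidegree `a` it adds to a symbol the first index
`q` such that `m_q` divides the monomial with exponent `a`, if the symbol does not contain it. -/
def homotopy : LModule K m t →ₗ[K] LModule K m (t + 1) :=
  Finsupp.lsum K fun u : AdmissibleSymb m t =>
    (basisMonomials (Fin n) K).constr K fun b =>
      if h : ∃ q, IsFirst m (b + symbLcm m u.1) q ∧ ∀ k, q < u.1 k then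
        basisMultiple K ⟨Symb.cons h.choose u.1 h.choose_spec.2,
          u.2.cons le_add_self h.choose_spec.1 h.choose_spec.2⟩ (b + symbLcm m u.1)
      else 0

open Classical in
theorem homotopy_basisMultiple (u : AdmissibleSymb m t) {a : Fin n →₀ ℕ}
    (ha : symbLcm m u.1 ≤ a) : homotopy K m t (basisMultiple K u a) =
      if h : ∃ q, IsFirst m a q ∧ ∀ k, q < u.1 k then
        basisMultiple K ⟨Symb.cons h.choose u.1 h.choose_spec.2,
          u.2.cons ha h.choose_spec.1 h.choose_spec.2⟩ a
      else 0 := by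
  obtain ⟨b, rfl⟩ : ∃ b, a = b + symbLcm m u.1 := ⟨_, (tsub_add_cancel_of_le ha).symm⟩
  rw [homotopy, basisMultiple, add_tsub_cancel_right, Finsupp.lsum_single]
  exact Module.Basis.constr_basis (basisMonomials (Fin n) K) K _ b

theorem homotopy_of_isFirst (u : AdmissibleSymb m t) {a : Fin n →₀ ℕ}
    (ha : symbLcm m u.1 ≤ a) {q : Fin μ} (hq : IsFirst m a q) (h : ∀ k, q < u.1 k) :
    homotopy K m t (basisMultiple K u a) =
      basisMultiple K ⟨Symb.cons q u.1 h, u.2.cons ha hq h⟩ a := by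
  have hex : ∃ q, IsFirst m a q ∧ ∀ k, q < u.1 k := ⟨q, hq, h⟩
  rw [homotopy_basisMultiple u ha, dif_pos hex]
  congr 2
  congr 1
  exact hex.choose_spec.1.unique hq

theorem homotopy_eq_zero (u : AdmissibleSymb m t) {a : Fin n →₀ ℕ}
    (ha : symbLcm m u.1 ≤ a) {q : Fin μ} (hq : IsFirst m a q) {k : Fin t} (h : u.1 k = q) :
    homotopy K m t (basisMultiple K u a) = 0 := by
  rw [homotopy_basisMultiple u ha, dif_neg]
  rintro ⟨p, hp, hlt⟩
  have := hlt k
  rw [h, hp.unique hq] at this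
  exact lt_irrefl _ this

/-- The cone identity, in positive homological degree only: there a symbol has a first entry whose
generator divides `x^a`, so an apex `q` exists and `q ≤ u 0`. -/
theorem homotopy_identity (x : LModule K m (t + 1)) :
    boundary K m (t + 1) (homotopy K m (t + 1) x) + homotopy K m t (boundary K m t x) = x := by
  suffices h : (boundary K m (t + 1)).restrictScalars K ∘ₗ homotopy K m (t + 1) +
      homotopy K m t ∘ₗ (boundary K m t).restrictScalars K = LinearMap.id from
    DFunLike.congr_fun h x
  refine LModule.hom_ext fun u a ha => ?_
  change boundary K m (t + 1) (homotopy K m (t + 1) (basisMultiple K u a)) +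
    homotopy K m t (boundary K m t (basisMultiple K u a)) = basisMultiple K u a
  have hface : ∀ k, symbLcm m (u.face k).1 ≤ a := fun k => (symbLcm_face_le u.1 k).trans ha
  obtain ⟨q, hqu, hq⟩ := exists_isFirst_le (symbLcm_le_iff.mp ha 0)
  rw [boundary_basisMultiple u ha, map_sum]
  simp only [map_smul]
  -- If `q` already is the first entry, the homotopy kills the symbol and every face still
  -- containing `q`; the face omitting `q` gets it back. If `q` precedes all entries, face `0` of
  -- the cone returns the symbol and the remaining faces cancel in pairs.
  rcases hqu.eq_or_lt with rfl | hlt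
  · rw [homotopy_eq_zero u ha hq (k := 0) rfl, map_zero, zero_add, Fin.sum_univ_succ,
      homotopy_of_isFirst _ (hface 0) hq fun k => u.1.lt_iff_lt.mpr k.succ_pos]
    have h0 : ∀ k : Fin t, homotopy K m t (basisMultiple K (u.face k.succ) a) = 0 := by
      intro k
      obtain ⟨t, rfl⟩ : ∃ s, t = s + 1 := ⟨t - 1, by have := k.pos; omega⟩
      exact homotopy_eq_zero _ (hface _) hq (k := 0)
        (congrArg u.1 (Fin.succAbove_ne_zero_zero (Fin.succ_ne_zero k)))
    simp only [h0, smul_zero, Finset.sum_const_zero, add_zero, Fin.val_zero, pow_zero, one_smul]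
    congr 1
    exact Subtype.ext (cons_face_zero u.1)
  · have hall : ∀ k, q < u.1 k := fun k => hlt.trans_le (u.1.le_iff_le.mpr (Fin.zero_le k))
    rw [homotopy_of_isFirst u ha hq hall, boundary_basisMultiple _ (symbLcm_cons_le hall hq.1 ha),
      Fin.sum_univ_succ, add_assoc, ← Finset.sum_add_distrib]
    have h0 : (AdmissibleSymb.face ⟨Symb.cons q u.1 hall, u.2.cons ha hq hall⟩ 0 :
        AdmissibleSymb m (t + 1)) = u := Subtype.ext (face_cons_zero q u.1 hall)
    rw [h0, Finset.sum_eq_zero, add_zero, Fin.val_zero, pow_zero, one_smul]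
    intro k _
    rw [homotopy_of_isFirst _ (hface k) hq (lt_face hall k), Fin.val_succ, pow_succ, mul_neg_one,
      neg_smul]
    have hs : (AdmissibleSymb.face ⟨Symb.cons q u.1 hall, u.2.cons ha hq hall⟩ k.succ :
        AdmissibleSymb m (t + 1)) = ⟨Symb.cons q (face u.1 k) (lt_face hall k),
          (u.2.face k).cons (hface k) hq (lt_face hall k)⟩ :=
      Subtype.ext (face_cons_succ q u.1 hall k)
    rw [hs]
    exact neg_add_cancel _

theorem boundary_exact (t : ℕ) : Function.Exact (boundary K m (t + 1)) (boundary K m t) := by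
  intro x
  refine ⟨fun hx => ⟨homotopy K m (t + 1) x, ?_⟩, ?_⟩
  · have := homotopy_identity x
    rwa [hx, map_zero, add_zero] at this
  · rintro ⟨y, rfl⟩
    exact boundary_boundary y

/-- The empty symbol, which is `L`-admissible. -/
def emptySymb (m : Fin μ → Fin n →₀ ℕ) : AdmissibleSymb m 0 :=
  ⟨OrderEmbedding.ofIsEmpty, fun h => h.elim0⟩

instance : Subsingleton (AdmissibleSymb m 0) :=
  ⟨fun _ _ => Subtype.ext (RelEmbedding.ext fun k => k.elim0)⟩

/-- The symbol `u(i)`, which is `L`-admissible. -/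
def singletonSymb (m : Fin μ → Fin n →₀ ℕ) (i : Fin μ) : AdmissibleSymb m 1 :=
  ⟨Symb.cons i OrderEmbedding.ofIsEmpty fun k => k.elim0, fun h hh => by omega⟩

variable (K m) in
/-- The identification `L^0 = R`. -/
def zeroEquiv : LModule K m 0 ≃ₗ[MvPolynomial (Fin n) K] MvPolynomial (Fin n) K :=
  Finsupp.uniqueLinearEquiv _ _ (emptySymb m)

theorem symbLcm_zero (u : Symb μ 0) : symbLcm m u = 0 := by
  rw [symbLcm, Finset.univ_eq_empty, Finset.sup_empty]
  rfl

theorem symbLcm_one (u : Symb μ 1) : symbLcm m u = m (u 0) := by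
  simp [symbLcm]

theorem zeroEquiv_boundary_single (u : AdmissibleSymb m 1) :
    zeroEquiv K m (boundary K m 0 (Finsupp.single u 1)) = monomial (m (u.1 0)) 1 := by
  rw [single_eq_basisMultiple, boundary_basisMultiple u le_rfl, Fin.sum_univ_one, Fin.val_zero, pow_zero, one_smul,
    basisMultiple, symbLcm_one, symbLcm_zero, tsub_zero, zeroEquiv,
    Finsupp.uniqueLinearEquiv_apply, Subsingleton.elim (u.face 0) (emptySymb m),
    Finsupp.single_eq_same]

theorem range_zeroEquiv_boundary :
    LinearMap.range ((zeroEquiv K m).toLinearMap ∘ₗ boundary K m 0) =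
      Ideal.span ((fun a => monomial a (1 : K)) '' Set.range m) := by
  rw [← Submodule.map_top, ← (Finsupp.basisSingleOne (ι := AdmissibleSymb m 1)).span_eq,
    Submodule.map_span, ← Set.range_comp, ← Set.range_comp]
  refine congrArg (Submodule.span _) (Set.ext fun x => ⟨?_, ?_⟩)
  · rintro ⟨u, rfl⟩
    exact ⟨u.1 0, by simp [zeroEquiv_boundary_single]⟩
  · rintro ⟨i, rfl⟩
    exact ⟨singletonSymb m i, by simp [zeroEquiv_boundary_single, singletonSymb]⟩

end Exactness

/-! ### The minimal graded free resolutions of `R/I` and `I` -/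

section Resolution

variable {K : Type*} [Field K] {n μ : ℕ} {m : Fin μ → Fin n →₀ ℕ}

instance (t : ℕ) : Finite (Symb μ t) := Finite.of_injective _ DFunLike.coe_injective

variable (m) in
/-- An enumeration of the `L`-admissible symbols of dimension `t`. -/
def symbEquiv (t : ℕ) : AdmissibleSymb m t ≃ Fin (Nat.card (AdmissibleSymb m t)) :=
  Finite.equivFin _

variable (m) in
/-- The degrees of the basis elements of `L^t`. -/
def symbDeg (t : ℕ) (b : Fin (Nat.card (AdmissibleSymb m t))) : ℕ :=
  (symbLcm m ((symbEquiv m t).symm b).1).degree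

variable (K m) in
/-- The identification of `L^t` with a module of columns. -/
def columnEquiv (t : ℕ) : LModule K m t ≃ₗ[MvPolynomial (Fin n) K]
    (Fin (Nat.card (AdmissibleSymb m t)) → MvPolynomial (Fin n) K) :=
  Finsupp.domLCongr (symbEquiv m t) ≪≫ₗ Finsupp.linearEquivFunOnFinite _ _ _

theorem columnEquiv_single (t : ℕ) (u : AdmissibleSymb m t) (p : MvPolynomial (Fin n) K) :
    columnEquiv K m t (Finsupp.single u p) = Pi.single (symbEquiv m t u) p := by
  classical
  rw [columnEquiv, LinearEquiv.trans_apply, Finsupp.domLCongr_single,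
    Finsupp.linearEquivFunOnFinite_single]

theorem columnEquiv_symm_single (t : ℕ) (b : Fin (Nat.card (AdmissibleSymb m t)))
    (p : MvPolynomial (Fin n) K) :
    (columnEquiv K m t).symm (Pi.single b p) = Finsupp.single ((symbEquiv m t).symm b) p := by
  rw [LinearEquiv.symm_apply_eq, columnEquiv_single, Equiv.apply_symm_apply]

theorem columnEquiv_basisMultiple_mem {t : ℕ} (u : AdmissibleSymb m t) {a : Fin n →₀ ℕ}
    (ha : symbLcm m u.1 ≤ a) :
    columnEquiv K m t (basisMultiple K u a) ∈ freeGrading K n (symbDeg m t) a.degree := by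
  rw [basisMultiple, columnEquiv_single]
  have h := single_monomial_mem_freeGrading (symbDeg m t) (symbEquiv m t u)
    (a - symbLcm m u.1) (1 : K)
  rwa [symbDeg, Equiv.symm_apply_apply, ← map_add, tsub_add_cancel_of_le ha] at h

variable (K m) in
/-- The differential of the Lyubeznik resolution as a map between modules of columns. -/
def columnBoundary (t : ℕ) :
    (Fin (Nat.card (AdmissibleSymb m (t + 1))) → MvPolynomial (Fin n) K) →ₗ[MvPolynomial (Fin n) K]
      (Fin (Nat.card (AdmissibleSymb m t)) → MvPolynomial (Fin n) K) :=
  (columnEquiv K m t).toLinearMap ∘ₗ boundary K m t ∘ₗ (columnEquiv K m (t + 1)).symm.toLinearMap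

theorem columnBoundary_apply (t : ℕ) (v) :
    columnBoundary K m t v = columnEquiv K m t (boundary K m t ((columnEquiv K m (t + 1)).symm v)) :=
  rfl

theorem columnBoundary_homogeneous (t j : ℕ) (v) (hv : v ∈ freeGrading K n (symbDeg m (t + 1)) j) :
    columnBoundary K m t v ∈ freeGrading K n (symbDeg m t) j := by
  refine mapsTo_freeGrading (symbDeg m (t + 1)) (symbDeg m t) (fun b => ?_) hv
  rw [columnBoundary_apply, columnEquiv_symm_single, single_eq_basisMultiple,
    boundary_basisMultiple _ le_rfl, map_sum, ← mem_freeGradingSubgroup]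
  refine sum_mem fun k _ => ?_
  rcases neg_one_pow_eq_or K (k : ℕ) with h | h <;> rw [h]
  · rw [one_smul]
    exact columnEquiv_basisMultiple_mem _ (symbLcm_face_le _ k)
  · rw [neg_one_smul, map_neg]
    exact neg_mem (columnEquiv_basisMultiple_mem _ (symbLcm_face_le _ k))

theorem columnBoundary_exact (t : ℕ) :
    Function.Exact (columnBoundary K m (t + 1)) (columnBoundary K m t) := by
  intro v
  rw [columnBoundary_apply, LinearEquiv.map_eq_zero_iff, boundary_exact t]
  constructor
  · rintro ⟨y, hy⟩
    exact ⟨columnEquiv K m (t + 2) y, by simp [columnBoundary_apply, hy]⟩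
  · rintro ⟨w, rfl⟩
    exact ⟨(columnEquiv K m (t + 2)).symm w, by simp [columnBoundary_apply]⟩

theorem columnBoundary_minimal (hmin : IsMinimalLyubeznik K m) (t : ℕ) :
    LinearMap.range (columnBoundary K m t) ≤
      irrelevantIdeal K n • (⊤ : Submodule (MvPolynomial (Fin n) K) _) := by
  rintro _ ⟨v, rfl⟩
  rw [columnBoundary_apply]
  have h := Submodule.mem_map_of_mem (f := (columnEquiv K m t).toLinearMap)
    (hmin t (LinearMap.mem_range_self _ ((columnEquiv K m (t + 1)).symm v)))
  rw [Submodule.map_smul''] at h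
  exact Submodule.smul_mono le_rfl le_top h

variable (K m) in
/-- The identification of the module of columns of `L^0` with `R`. -/
def columnZeroEquiv : (Fin (Nat.card (AdmissibleSymb m 0)) → MvPolynomial (Fin n) K)
    ≃ₗ[MvPolynomial (Fin n) K] MvPolynomial (Fin n) K :=
  (columnEquiv K m 0).symm ≪≫ₗ zeroEquiv K m

theorem columnZeroEquiv_homogeneous (j : ℕ) (v) (hv : v ∈ freeGrading K n (symbDeg m 0) j) :
    columnZeroEquiv K m v ∈ homogeneousSubmodule (Fin n) K j := by
  have h : columnZeroEquiv K m v = v (symbEquiv m 0 (emptySymb m)) := by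
    obtain ⟨x, rfl⟩ := (columnEquiv K m 0).surjective v
    obtain ⟨p, rfl⟩ := (zeroEquiv K m).symm.surjective x
    rw [columnZeroEquiv, LinearEquiv.trans_apply, LinearEquiv.symm_apply_apply,
      LinearEquiv.apply_symm_apply]
    have : (zeroEquiv K m).symm p = Finsupp.single (emptySymb m) p := rfl
    rw [this, columnEquiv_single, Pi.single_eq_same]
  rw [h, mem_homogeneousSubmodule]
  intro a ha
  have hd := hv _ a (mem_support_iff.mpr ha)
  rwa [symbDeg, symbLcm_zero, map_zero, add_zero, Finsupp.degree_eq_weight_one] at hd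

variable {I : Ideal (MvPolynomial (Fin n) K)}

/-- This links the complex to the modules: it gives exactness at `F_0` for `R/I` and surjectivity of
the augmentation for `I`. -/
theorem range_columnZeroEquiv_columnBoundary (hI : IsMonomialIdeal I)
    (hG : Set.range m = minGens I) :
    LinearMap.range ((columnZeroEquiv K m).toLinearMap ∘ₗ columnBoundary K m 0) = I := by
  have h : (columnZeroEquiv K m).toLinearMap ∘ₗ columnBoundary K m 0 =
      ((zeroEquiv K m).toLinearMap ∘ₗ boundary K m 0) ∘ₗ (columnEquiv K m 1).symm.toLinearMap :=
    LinearMap.ext fun v => congrArg (zeroEquiv K m) ((columnEquiv K m 0).symm_apply_apply _)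
  rw [h, LinearMap.range_comp_of_range_eq_top _ (LinearEquiv.range _), range_zeroEquiv_boundary, hG]
  exact hI.eq_span_minGens.symm

/-- The minimal graded free resolution of `R/I` given by a minimal Lyubeznik resolution. -/
def quotientResolution (hI : IsMonomialIdeal I) (hG : Set.range m = minGens I)
    (hmin : IsMinimalLyubeznik K m) :
    MinimalGradedResolution (K := K) (n := n) (quotientGrading I) where
  rank t := Nat.card (AdmissibleSymb m t)
  deg t := symbDeg m t
  d t := columnBoundary K m t
  aug := Submodule.mkQ I ∘ₗ (columnZeroEquiv K m).toLinearMap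
  aug_surjective := (Submodule.mkQ_surjective I).comp (columnZeroEquiv K m).surjective
  exact_zero v := by
    have h := SetLike.ext_iff.mp (range_columnZeroEquiv_columnBoundary hI hG)
      (columnZeroEquiv K m v)
    rw [LinearMap.comp_apply, Submodule.mkQ_apply, Submodule.Quotient.mk_eq_zero]
    refine h.symm.trans (exists_congr fun w => ?_)
    exact (columnZeroEquiv K m).injective.eq_iff
  exact_succ t := columnBoundary_exact t
  aug_homogeneous j v hv := ⟨_, columnZeroEquiv_homogeneous j v hv, rfl⟩
  d_homogeneous t := columnBoundary_homogeneous t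
  minimal := columnBoundary_minimal hmin

/-- The minimal graded free resolution of `I` given by a minimal Lyubeznik resolution. -/
def idealResolution (hI : IsMonomialIdeal I) (hG : Set.range m = minGens I)
    (hmin : IsMinimalLyubeznik K m) :
    MinimalGradedResolution (K := K) (n := n) (idealGrading I) where
  rank t := Nat.card (AdmissibleSymb m (t + 1))
  deg t := symbDeg m (t + 1)
  d t := columnBoundary K m (t + 1)
  aug := LinearMap.codRestrict I ((columnZeroEquiv K m).toLinearMap ∘ₗ columnBoundary K m 0)
    fun v => (range_columnZeroEquiv_columnBoundary hI hG).le (LinearMap.mem_range_self _ v)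
  aug_surjective := fun ⟨x, hx⟩ => by
    obtain ⟨v, hv⟩ := (SetLike.ext_iff.mp (range_columnZeroEquiv_columnBoundary hI hG) x).mpr hx
    exact ⟨v, Subtype.ext hv⟩
  exact_zero v := by
    rw [← columnBoundary_exact 0 v]
    exact Subtype.ext_iff.trans (columnZeroEquiv K m).map_eq_zero_iff
  exact_succ t := columnBoundary_exact (t + 1)
  aug_homogeneous j v hv :=
    columnZeroEquiv_homogeneous j _ (columnBoundary_homogeneous 0 j v hv)
  d_homogeneous t := columnBoundary_homogeneous (t + 1)
  minimal t := columnBoundary_minimal hmin (t + 1)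

theorem card_symbDeg_eq (t j : ℕ) : Nat.card {b // symbDeg m t b = j} =
    Set.ncard {u : Symb μ t | IsAdmissible m u ∧ (symbLcm m u).degree = j} := by
  rw [← Nat.card_coe_set_eq]
  have e : {u : AdmissibleSymb m t // (symbLcm m u.1).degree = j} ≃ {b // symbDeg m t b = j} :=
    (symbEquiv m t).subtypeEquiv fun u => by rw [symbDeg, Equiv.symm_apply_apply]
  rw [← Nat.card_congr e]
  exact Nat.card_congr (Equiv.subtypeSubtypeEquivSubtypeInter (fun u : Symb μ t => IsAdmissible m u)
    fun u => (symbLcm m u).degree = j)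

end Resolution

/-! ### Preserved sets -/

section Preserved

variable {n μ : ℕ} {m : Fin μ → Fin n →₀ ℕ} {t : ℕ}

/-- The set of monomials of a symbol. -/
def symbSet (hinj : Function.Injective m) (u : Symb μ t) : Finset (Fin n →₀ ℕ) :=
  Finset.univ.map (u.toEmbedding.trans ⟨m, hinj⟩)

variable (hinj : Function.Injective m)

theorem mem_symbSet {u : Symb μ t} {a : Fin n →₀ ℕ} : a ∈ symbSet hinj u ↔ ∃ k, m (u k) = a := by
  simp [symbSet]

theorem sup_symbSet (u : Symb μ t) : (symbSet hinj u).sup id = symbLcm m u := by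
  rw [symbSet, Finset.sup_map]
  rfl

theorem isPreserved_symbSet_iff (hanti : ∀ i j, m i ≤ m j → i = j) (u : Symb μ t) :
    IsPreserved m (symbSet hinj u) ↔ IsAdmissible m u := by
  classical
  constructor
  · intro hu h _ q hq hle
    -- A failure of admissibility at `h` makes the tail starting at `h` a broken subset.
    refine hu ((Finset.Ici h).image fun k => m (u k)) (fun a ha => ?_) ⟨?_, m q, ⟨q, rfl⟩, ?_, ?_⟩
    · obtain ⟨k, -, rfl⟩ := Finset.mem_image.mp ha
      exact (mem_symbSet hinj).mpr ⟨k, rfl⟩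
    · exact ⟨_, Finset.mem_image_of_mem _ (Finset.mem_Ici.mpr le_rfl)⟩
    · rw [Finset.sup_image]
      exact hle
    · intro v hv
      obtain ⟨k, hk, rfl⟩ := Finset.mem_image.mp hv
      exact ⟨q, u k, hq.trans_le (u.le_iff_le.mpr (Finset.mem_Ici.mp hk)), rfl, rfl⟩
  · rintro hu D hD ⟨hne, _, ⟨q, rfl⟩, hle, hprec⟩
    have hne' : (Finset.univ.filter fun k => m (u k) ∈ D).Nonempty := by
      obtain ⟨a, ha⟩ := hne
      obtain ⟨k, rfl⟩ := (mem_symbSet hinj).mp (hD ha)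
      exact ⟨k, by simpa using ha⟩
    -- With `h` the first position that meets `D`, the lcm of `D` divides that of the tail from `h`.
    obtain ⟨h, hh⟩ := Finset.exists_minimal hne'
    have hhD : m (u h) ∈ D := (Finset.mem_filter.mp hh.prop).2
    have hq : q < u h := by
      obtain ⟨p, p', hlt, hp, hp'⟩ := hprec _ hhD
      rwa [hinj hp, hinj hp'] at hlt
    have hle' : m q ≤ (Finset.Ici h).sup fun k => m (u k) := by
      refine hle.trans (Finset.sup_le fun a ha => ?_)
      obtain ⟨k, rfl⟩ := (mem_symbSet hinj).mp (hD ha)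
      refine Finset.le_sup (f := fun k => m (u k)) (Finset.mem_Ici.mpr ?_)
      rcases le_total h k with hk | hk
      · exact hk
      · exact hh.le_of_le (by simpa using ha) hk
    -- Admissibility does not test the last position. There the tail is a single generator, and an
    -- earlier one cannot divide it because the generators form an antichain.
    by_cases hlast : (h : ℕ) + 1 < t
    · exact hu h hlast q hq hle'
    · have : Finset.Ici h = {h} := by
        ext k
        rw [Finset.mem_Ici, Finset.mem_singleton, Fin.le_def, Fin.ext_iff]
        omega
      rw [this, Finset.sup_singleton] at hle'
      exact hq.ne (hanti _ _ hle')

theorem symbSet_injective : Function.Injective (symbSet (t := t) hinj) := by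
  intro u v huv
  refine RelEmbedding.coe_fn_injective ((StrictMono.range_inj u.strictMono v.strictMono).mp ?_)
  refine hinj.image_injective (Set.ext fun a => ?_)
  have := Finset.ext_iff.mp huv a
  rw [mem_symbSet, mem_symbSet] at this
  simpa using this

theorem exists_symbSet_eq {A : Finset (Fin n →₀ ℕ)} (hA : (A : Set (Fin n →₀ ℕ)) ⊆ Set.range m)
    (hcard : A.card = t) : ∃ u : Symb μ t, symbSet hinj u = A := by
  classical
  obtain ⟨B, rfl⟩ : ∃ B : Finset (Fin μ), B.map ⟨m, hinj⟩ = A := by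
    refine ⟨A.preimage m hinj.injOn, Finset.coe_injective ?_⟩
    rw [Finset.coe_map, Finset.coe_preimage]
    exact Set.image_preimage_eq_of_subset hA
  rw [Finset.card_map] at hcard
  refine ⟨B.orderEmbOfFin hcard, ?_⟩
  rw [symbSet, ← Finset.map_map]
  congr 1
  exact Finset.map_orderEmbOfFin_univ B hcard

theorem ncard_isAdmissible_eq_ncard_isPreserved (hinj : Function.Injective m)
    (hanti : ∀ i j, m i ≤ m j → i = j) (t j : ℕ) :
    Set.ncard {u : Symb μ t | IsAdmissible m u ∧ (symbLcm m u).degree = j} =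
      Set.ncard {A : Finset (Fin n →₀ ℕ) | (A : Set (Fin n →₀ ℕ)) ⊆ Set.range m ∧ A.card = t ∧
        IsPreserved m A ∧ (A.sup id).degree = j} := by
  rw [← Set.ncard_image_of_injective _ (symbSet_injective hinj)]
  congr 1
  ext A
  constructor
  · rintro ⟨u, ⟨hu, hd⟩, rfl⟩
    refine ⟨fun a ha => ?_, by simp [symbSet], (isPreserved_symbSet_iff hinj hanti u).mpr hu, ?_⟩
    · obtain ⟨k, rfl⟩ := (mem_symbSet hinj).mp ha
      exact ⟨_, rfl⟩
    · rwa [sup_symbSet]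
  · rintro ⟨hA, hcard, hpres, hd⟩
    obtain ⟨u, rfl⟩ := exists_symbSet_eq hinj hA hcard
    rw [sup_symbSet] at hd
    exact ⟨u, ⟨(isPreserved_symbSet_iff hinj hanti u).mp hpres, hd⟩, rfl⟩

end Preserved

end Lyubeznik

end

theorem mainTheorem5 {K : Type*} [Field K] {n : ℕ} (I : Ideal (MvPolynomial (Fin n) K))
    (hI : Lyubeznik.IsMonomialIdeal I) {μ : ℕ} (m : Fin μ → Fin n →₀ ℕ)
    (hinj : Function.Injective m) (hG : Set.range m = Lyubeznik.minGens I)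
    (hmin : Lyubeznik.IsMinimalLyubeznik K m) :
    Nonempty (Lyubeznik.MinimalGradedResolution (K := K) (n := n)
      (Lyubeznik.quotientGrading I)) ∧
    Nonempty (Lyubeznik.MinimalGradedResolution (K := K) (n := n)
      (Lyubeznik.idealGrading I)) ∧
    ∀ t j : ℕ, 1 ≤ t →
      Lyubeznik.bettiQuotient I t j = Lyubeznik.bettiIdeal I (t - 1) j ∧
      Lyubeznik.bettiIdeal I (t - 1) j =
        Set.ncard {u : Lyubeznik.Symb μ t |
          Lyubeznik.IsAdmissible m u ∧ (Lyubeznik.symbLcm m u).degree = j} ∧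
      Lyubeznik.bettiIdeal I (t - 1) j =
        Set.ncard {A : Finset (Fin n →₀ ℕ) |
          (A : Set (Fin n →₀ ℕ)) ⊆ Lyubeznik.minGens I ∧ A.card = t ∧
            Lyubeznik.IsPreserved m A ∧ (A.sup id).degree = j} := by
  refine ⟨⟨Lyubeznik.quotientResolution hI hG hmin⟩, ⟨Lyubeznik.idealResolution hI hG hmin⟩,
    fun t j ht => ?_⟩
  obtain ⟨t, rfl⟩ : ∃ s, t = s + 1 := ⟨t - 1, by omega⟩
  rw [Nat.add_sub_cancel]
  have hmem : ∀ i, m i ∈ Lyubeznik.minGens I := fun i => hG ▸ Set.mem_range_self i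
  have hanti : ∀ i j, m i ≤ m j → i = j := fun i j hij =>
    hinj (Lyubeznik.eq_of_le_of_mem_minGens (hmem i) (hmem j) hij)
  have h1 : Lyubeznik.bettiQuotient I (t + 1) j = _ :=
    Lyubeznik.gradedBetti_eq hI.hasProjections_quotientGrading
      (Lyubeznik.quotientResolution hI hG hmin) (t + 1) j
  have h2 : Lyubeznik.bettiIdeal I t j = _ :=
    Lyubeznik.gradedBetti_eq hI.hasProjections_idealGrading
      (Lyubeznik.idealResolution hI hG hmin) t j
  have h3 : (Lyubeznik.idealResolution hI hG hmin).betti t j =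
      Set.ncard {u : Lyubeznik.Symb μ (t + 1) |
        Lyubeznik.IsAdmissible m u ∧ (Lyubeznik.symbLcm m u).degree = j} :=
    Lyubeznik.card_symbDeg_eq (t + 1) j
  -- Both resolutions use the same `symbDeg`, shifted by one index, so the two Betti counts agree by
  -- definition.
  refine ⟨h1.trans h2.symm, h2.trans h3, ?_⟩
  rw [h2, h3, Lyubeznik.ncard_isAdmissible_eq_ncard_isPreserved hinj hanti, hG]
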